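/- Let $(R,\mathfrak m)$ be a Noetherian local ring of dimension $d$ and of prime characteristic $p>0$. For an ideal $J\subseteq R$ and $e\in\mathbb N$ let $J^{[p^e]}$ be the ideal generated by the elements $x^{p^e}$, $x\in J$. Local cohomology $H^j_{\mathfrak m}$ is computed by the Čech complex on a fixed finite sequence of generators of $\mathfrak m$. The Frobenius endomorphism of $R$ induces the standard Frobenius action $F$ on $H^j_{\mathfrak m}(R)$, and the maps $R/J\to R/J^{[p^e]}$, $x+J\mapsto x^{p^e}+J^{[p^e]}$, induce the relative Frobenius actions $F_R^e\colon H^j_{\mathfrak m}(R/J)\to H^j_{\mathfrak m}(R/J^{[p^e]})$. Put $$0^F_{H^j_{\mathfrak m}(R)}=\{\xi\in H^j_{\mathfrak m}(R)\mid F^e(\xi)=0\text{ for some }e\in\mathbb N\},\qquad 0^{F_R}_{H^j_{\mathfrak m}(R/J)}=\{\xi\in H^j_{\mathfrak m}(R/J)\mid F_R^e(\xi)=0\text{ for some }e\in\mathbb N\}.$$ Suppose that $R$ is generalized weakly F-nilpotent, i.e. that $H^j_{\mathfrak m}(R)/0^F_{H^j_{\mathfrak m}(R)}$ has finite length for all $0\le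 j<d$. Then there is an $e_0\in\mathbb N$ such that for all $e\ge e_0$, for every system of parameters $x_1,\dots,x_d$ of $R$ which is filter regular (that is, for each $i$, $x_i\in\mathfrak m$ and $x_i\notin\mathfrak p$ for every $\mathfrak p\in\operatorname{Ass}_R(R/(x_1,\dots,x_{i-1}))$ with $\mathfrak p\ne\mathfrak m$), and for all $i,j\ge 0$ with $i+j<d$, writing $\mathfrak q=(x_1,\dots,x_d)$ and $\mathfrak q_i=(x_1,\dots,x_i)$, we have $$\mathfrak q^{[p^e]}\cdot H^j_{\mathfrak m}\bigl(R/\mathfrak q_i^{[p^e]}\bigr)\subseteq 0^{F_R}_{H^j_{\mathfrak m}(R/\mathfrak q_i^{[p^e]})}.$$ -/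

import Mathlib

namespace FNilp

/-! ### Localized modules `M_a` and the maps between them -/

section Localization

variable {R : Type*} [CommRing R]

/-- The localization `M_a` of the module `M` at the powers of `a`. -/
abbrev Away (a : R) (M : Type*) [AddCommGroup M] [Module R M] : Type _ :=
  LocalizedModule (Submonoid.powers a) M

theorem isUnit_of_dvd {M : Type*} [AddCommGroup M] [Module R M] {a b : R} (h : a ∣ b)
    (s : Submonoid.powers a) :
    IsUnit (algebraMap R (Module.End R (Away b M)) (s : R)) := by
  obtain ⟨_, k, rfl⟩ := s
  have hb := IsLocalizedModule.map_units (S := Submonoid.powers b)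
    (LocalizedModule.mkLinearMap (Submonoid.powers b) M)
    (⟨b ^ k, k, rfl⟩ : Submonoid.powers b)
  obtain ⟨c, hc⟩ := pow_dvd_pow_of_dvd h k
  have hcomm : Commute (algebraMap R (Module.End R (Away b M)) (a ^ k))
      (algebraMap R (Module.End R (Away b M)) c) := Algebra.commutes _ _
  have hb' : IsUnit (algebraMap R (Module.End R (Away b M)) (b ^ k)) := hb
  rw [hc, map_mul, hcomm.isUnit_mul_iff] at hb'
  exact hb'.1

/-- The natural map `M_a → M_b`, `m / a ^ k ↦ (b / a) ^ k m / b ^ k`, for `a ∣ b`. -/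
noncomputable def awayMap (M : Type*) [AddCommGroup M] [Module R M] {a b : R} (h : a ∣ b) :
    Away a M →ₗ[R] Away b M :=
  LocalizedModule.lift (Submonoid.powers a)
    (LocalizedModule.mkLinearMap (Submonoid.powers b) M) (isUnit_of_dvd h)

theorem awayMap_mk_one {M : Type*} [AddCommGroup M] [Module R M] {a b : R} (h : a ∣ b) (m : M) :
    awayMap M h (LocalizedModule.mk m 1) = LocalizedModule.mk m 1 :=
  LocalizedModule.lift_mk_one _ _ (isUnit_of_dvd h) m

theorem awayMap_awayMap {M : Type*} [AddCommGroup M] [Module R M] {a b c : R} (h : a ∣ b)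
    (h' : b ∣ c) (x : Away a M) :
    awayMap M h' (awayMap M h x) = awayMap M (h.trans h') x := by
  have key : awayMap M h' ∘ₗ awayMap M h = awayMap M (h.trans h') := by
    refine IsLocalizedModule.ext (Submonoid.powers a)
      (LocalizedModule.mkLinearMap (Submonoid.powers a) M) (isUnit_of_dvd (h.trans h')) ?_
    ext m
    simp [awayMap_mk_one]
  exact LinearMap.congr_fun key x

/-- A ring endomorphism all of whose values are powers of the argument, such as the identity or
an iterate of the Frobenius endomorphism. -/
def IsPowerLike (σ : R →+* R) : Prop := ∀ a, ∃ k : ℕ, σ a = a ^ k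

theorem isPowerLike_iterateFrobenius (p : ℕ) [ExpChar R p] (e : ℕ) :
    IsPowerLike (iterateFrobenius R p e) := fun a => ⟨p ^ e, iterateFrobenius_def p e a⟩

theorem isPowerLike_frobenius (p : ℕ) [ExpChar R p] : IsPowerLike (frobenius R p) :=
  fun a => ⟨p, frobenius_def p a⟩

theorem IsPowerLike.mem {σ : R →+* R} (hσ : IsPowerLike σ) {a s : R}
    (hs : s ∈ Submonoid.powers a) : σ s ∈ Submonoid.powers a := by
  obtain ⟨k, hk⟩ := hσ s
  rw [hk]
  exact Submonoid.pow_mem _ hs k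

variable {M N : Type*} [AddCommGroup M] [Module R M] [AddCommGroup N] [Module R N]

/-- The `σ`-semilinear map `M_a → N_a`, `m / s ↦ g m / σ s`, induced by a `σ`-semilinear map
`g : M → N`. -/
noncomputable def awayFunctor {σ : R →+* R} (hσ : IsPowerLike σ) (g : M →ₛₗ[σ] N) (a : R) :
    Away a M →ₛₗ[σ] Away a N where
  toFun x := x.liftOn (fun q => LocalizedModule.mk (g q.1) ⟨σ q.2, hσ.mem q.2.2⟩) (by
    rintro ⟨m, s⟩ ⟨m', s'⟩ ⟨u, hu⟩
    refine LocalizedModule.mk_eq.2 ⟨⟨σ u, hσ.mem u.2⟩, ?_⟩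
    have := congrArg g hu
    simpa [Submonoid.smul_def, map_smulₛₗ] using this)
  map_add' x y := by
    induction x, y using LocalizedModule.induction_on₂ with
    | _ m m' s s' =>
      simp only [LocalizedModule.mk_add_mk, LocalizedModule.liftOn_mk]
      congr 1
      · simp [Submonoid.smul_def, map_smulₛₗ]
      · ext
        simp
  map_smul' r x := by
    induction x using LocalizedModule.induction_on with
    | _ m s =>
      simp only [LocalizedModule.smul'_mk, LocalizedModule.liftOn_mk, map_smulₛₗ]

theorem awayFunctor_mk {σ : R →+* R} (hσ : IsPowerLike σ) (g : M →ₛₗ[σ] N) (a : R) (m : M)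
    (s : Submonoid.powers a) :
    awayFunctor hσ g a (LocalizedModule.mk m s) =
      LocalizedModule.mk (g m) ⟨σ s, hσ.mem s.2⟩ := rfl

theorem awayFunctor_awayMap {σ : R →+* R} (hσ : IsPowerLike σ) (g : M →ₛₗ[σ] N) {a b : R}
    (h : a ∣ b) (x : Away a M) :
    awayFunctor hσ g b (awayMap M h x) = awayMap N h (awayFunctor hσ g a x) := by
  induction x using LocalizedModule.induction_on with
  | _ m s =>
    have hu := isUnit_of_dvd (M := N) h ⟨σ s, hσ.mem s.2⟩
    have hinj := ((Module.End.isUnit_iff _).1 hu).1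
    apply hinj
    have h1 : (s : R) • (LocalizedModule.mk m s : Away a M) = LocalizedModule.mk m 1 := by
      rw [LocalizedModule.smul'_mk]
      exact LocalizedModule.mk_cancel s m
    simp only [Module.algebraMap_end_apply]
    rw [← map_smulₛₗ, ← map_smul, h1, ← map_smul, ← map_smulₛₗ, h1, awayMap_mk_one]
    simp only [awayFunctor_mk]
    have h2 : ∀ c : R, (⟨σ (1 : Submonoid.powers c), hσ.mem (one_mem _)⟩ :
        Submonoid.powers c) = 1 := fun c => by ext; simp
    rw [h2, h2, awayMap_mk_one]

end Localization

/-! ### Čech cohomology -/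

section Cech

variable {R : Type*} [CommRing R] {n : ℕ} (f : Fin n → R)

/-- The degree `j` Čech cochains on `f`: the direct sum over `i₁ < ⋯ < i_j` of the localizations
of `M` at `f i₁ ⋯ f i_j`. -/
abbrev Cochain (M : Type*) [AddCommGroup M] [Module R M] (j : ℕ) : Type _ :=
  (s : {s : Finset (Fin n) // s.card = j}) → Away (∏ k ∈ s.1, f k) M

/-- The index set obtained from `t` by removing its element `i`. -/
def face {j : ℕ} (t : {t : Finset (Fin n) // t.card = j + 1}) (i : {i // i ∈ t.1}) :
    {s : Finset (Fin n) // s.card = j} :=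
  ⟨t.1.erase i.1, by rw [Finset.card_erase_of_mem i.2, t.2]; rfl⟩

theorem face_dvd {j : ℕ} (t : {t : Finset (Fin n) // t.card = j + 1}) (i : {i // i ∈ t.1}) :
    ∏ k ∈ (face t i).1, f k ∣ ∏ k ∈ t.1, f k :=
  Finset.prod_dvd_prod_of_subset _ _ _ (Finset.erase_subset _ _)

/-- The Čech differential: the component at `t` is the alternating sum over the elements `i` of `t`
of the images of the components at `t \ {i}`, the sign being given by the position of `i` in `t`. -/
noncomputable def cechD (M : Type*) [AddCommGroup M] [Module R M] (j : ℕ) :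
    Cochain f M j →ₗ[R] Cochain f M (j + 1) :=
  LinearMap.pi fun t => ∑ i : {i // i ∈ t.1},
    ((-1 : R) ^ (t.1.filter (· < i.1)).card) •
      (awayMap M (face_dvd f t i) ∘ₗ LinearMap.proj (face t i))

theorem cechD_apply {M : Type*} [AddCommGroup M] [Module R M] {j : ℕ} (c : Cochain f M j)
    (t : {t : Finset (Fin n) // t.card = j + 1}) :
    cechD f M j c t = ∑ i : {i // i ∈ t.1},
      ((-1 : R) ^ (t.1.filter (· < i.1)).card) • awayMap M (face_dvd f t i) (c (face t i)) := by
  rw [cechD, LinearMap.pi_apply, LinearMap.sum_apply]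
  rfl

theorem cechD_cechD (M : Type*) [AddCommGroup M] [Module R M] {j : ℕ} (c : Cochain f M j) :
    cechD f M (j + 1) (cechD f M j c) = 0 := by
  ext t
  have hcongr : ∀ {s s' : {s : Finset (Fin n) // s.card = j}} {b : R} (_ : s = s')
      (h : ∏ k ∈ s.1, f k ∣ b) (h' : ∏ k ∈ s'.1, f k ∣ b),
      awayMap M h (c s) = awayMap M h' (c s') := by
    rintro s _ b rfl h h'
    rfl
  have hsign : ∀ (a b : Fin n), a ∈ t.1 → b ∈ t.1 → a < b →
      ((-1 : R) ^ (t.1.filter (· < a)).card * (-1) ^ ((t.1.erase a).filter (· < b)).card) =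
        - ((-1 : R) ^ (t.1.filter (· < b)).card * (-1) ^ ((t.1.erase b).filter (· < a)).card) := by
    intro a b ha hb hab
    have h1 : ((t.1.erase a).filter (· < b)) = (t.1.filter (· < b)).erase a := by
      rw [Finset.filter_erase]
    have h2 : ((t.1.erase b).filter (· < a)) = t.1.filter (· < a) := by
      rw [Finset.filter_erase, Finset.erase_eq_of_notMem]
      simp [hab.le]
    have h3 := Finset.card_erase_add_one (s := t.1.filter (· < b)) (a := a) (by simp [ha, hab])
    rw [h1, h2, ← h3, pow_succ]
    ring
  simp only [cechD_apply, map_sum, map_smul, awayMap_awayMap, Finset.smul_sum, smul_smul,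
    Pi.zero_apply]
  rw [Finset.sum_sigma']
  refine Finset.sum_involution
    (fun q _ => ⟨⟨q.2.1, Finset.mem_of_mem_erase q.2.2⟩,
      ⟨q.1.1, Finset.mem_erase.2 ⟨(Finset.ne_of_mem_erase q.2.2).symm, q.1.2⟩⟩⟩) ?_ ?_ ?_ ?_
  · rintro ⟨⟨a, ha⟩, ⟨b, hb⟩⟩ -
    have hb' : b ∈ t.1 := Finset.mem_of_mem_erase hb
    have hne : b ≠ a := Finset.ne_of_mem_erase hb
    rw [hcongr (s := face (face t ⟨a, ha⟩) ⟨b, hb⟩)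
      (s' := face (face t ⟨b, hb'⟩) ⟨a, Finset.mem_erase.2 ⟨hne.symm, ha⟩⟩)
      (Subtype.ext Finset.erase_right_comm) _ ((face_dvd f _ _).trans (face_dvd f _ _)),
      ← add_smul]
    convert zero_smul R _
    simp only [face]
    rcases lt_or_gt_of_ne hne with h | h
    · rw [hsign b a hb' ha h]; ring
    · rw [hsign a b ha hb' h]; ring
  · rintro ⟨⟨a, ha⟩, ⟨b, hb⟩⟩ - _ h
    have hne : b ≠ a := Finset.ne_of_mem_erase hb
    exact hne (congrArg (fun q => q.1.1) h)
  · intro _ _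
    exact Finset.mem_univ _
  · rintro ⟨⟨a, ha⟩, ⟨b, hb⟩⟩ -
    rfl

/-- Čech cocycles. -/
noncomputable def cocycles (M : Type*) [AddCommGroup M] [Module R M] (j : ℕ) :
    Submodule R (Cochain f M j) := LinearMap.ker (cechD f M j)

/-- Čech coboundaries. -/
noncomputable def coboundaries (M : Type*) [AddCommGroup M] [Module R M] :
    (j : ℕ) → Submodule R (Cochain f M j)
  | 0 => ⊥
  | j + 1 => LinearMap.range (cechD f M j)

/-- The local cohomology module `H^j_I(M)` with respect to the ideal `I` generated by `f`, as the
cohomology of the Čech complex of `M` on `f`. -/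
abbrev LocCoh (M : Type*) [AddCommGroup M] [Module R M] (j : ℕ) : Type _ :=
  cocycles f M j ⧸ (coboundaries f M j).comap (cocycles f M j).subtype

variable {M N : Type*} [AddCommGroup M] [Module R M] [AddCommGroup N] [Module R N]

/-- The map on Čech cochains induced by a semilinear map. -/
noncomputable def cochainMap {σ : R →+* R} (hσ : IsPowerLike σ) (g : M →ₛₗ[σ] N) (j : ℕ) :
    Cochain f M j →ₛₗ[σ] Cochain f N j where
  toFun c s := awayFunctor hσ g _ (c s)
  map_add' c c' := by ext s; simp
  map_smul' r c := by ext s; simp [map_smulₛₗ]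

theorem cochainMap_cechD {σ : R →+* R} (hσ : IsPowerLike σ) (g : M →ₛₗ[σ] N) {j : ℕ}
    (c : Cochain f M j) :
    cechD f N j (cochainMap f hσ g j c) = cochainMap f hσ g (j + 1) (cechD f M j c) := by
  ext t
  simp only [cochainMap, LinearMap.coe_mk, AddHom.coe_mk, cechD_apply, map_sum, map_smulₛₗ, map_pow, map_neg, map_one,
    awayFunctor_awayMap]

/-- The map `H^j_I(M) → H^j_I(N)` induced by a semilinear map `M → N`. -/
noncomputable def locCohMap {σ : R →+* R} (hσ : IsPowerLike σ) (g : M →ₛₗ[σ] N) (j : ℕ) :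
    LocCoh f M j →ₛₗ[σ] LocCoh f N j :=
  Submodule.mapQ _ _
    ((cochainMap f hσ g j).restrict (p := cocycles f M j) (q := cocycles f N j) (by
      intro c hc
      rw [cocycles, LinearMap.mem_ker] at hc ⊢
      rw [cochainMap_cechD, hc, map_zero]))
    (by
      rintro ⟨c, hc⟩ h
      simp only [Submodule.mem_comap, Submodule.subtype_apply] at h ⊢
      change cochainMap f hσ g j c ∈ coboundaries f N j
      cases j with
      | zero =>
        have h0 : c = 0 := h
        rw [h0, map_zero]
        exact zero_mem _
      | succ j =>
        obtain ⟨b, hb⟩ := h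
        exact ⟨cochainMap f hσ g j b, by rw [cochainMap_cechD, hb]⟩)

theorem locCohMap_comp {L : Type*} [AddCommGroup L] [Module R L] {σ τ υ : R →+* R}
    (hσ : IsPowerLike σ) (hτ : IsPowerLike τ) (hυ : IsPowerLike υ) (hc : ∀ r, υ r = τ (σ r))
    (g : M →ₛₗ[σ] N) (g' : N →ₛₗ[τ] L) (g'' : M →ₛₗ[υ] L) (hg : ∀ m, g'' m = g' (g m)) (j : ℕ)
    (ξ : LocCoh f M j) :
    locCohMap f hυ g'' j ξ = locCohMap f hτ g' j (locCohMap f hσ g j ξ) := by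
  obtain ⟨⟨c, hcc⟩, rfl⟩ := Submodule.Quotient.mk_surjective _ ξ
  simp only [locCohMap, Submodule.mapQ_apply]
  congr 1
  ext s
  change awayFunctor hυ g'' _ (c s) = awayFunctor hτ g' _ (awayFunctor hσ g _ (c s))
  induction c s using LocalizedModule.induction_on with
  | _ m u =>
    simp only [awayFunctor_mk]
    congr 1
    · exact hg m
    · ext
      exact hc _

end Cech

/-! ### Frobenius -/

section Frobenius

variable {R : Type*} [CommRing R] (p : ℕ) [ExpChar R p]

/-- The submodule `0^F_M` of elements killed by some iterate of a Frobenius action `F` on `M`. -/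
def zeroFrobClosure {M : Type*} [AddCommGroup M] [Module R M] (F : M →ₛₗ[frobenius R p] M) :
    Submodule R M where
  carrier := {m | ∃ e : ℕ, F^[e] m = 0}
  zero_mem' := ⟨0, rfl⟩
  add_mem' := by
    rintro x y ⟨e, he⟩ ⟨e', he'⟩
    refine ⟨e + e', ?_⟩
    rw [iterate_map_add, add_comm e e', Function.iterate_add_apply F e' e x, he,
      add_comm e' e, Function.iterate_add_apply F e e' y, he', iterate_map_zero, iterate_map_zero,
      add_zero]
  smul_mem' := by
    rintro r x ⟨e, he⟩
    refine ⟨e, ?_⟩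
    have h : ∀ (k : ℕ) (a : R) (z : M), F^[k] (a • z) = (frobenius R p)^[k] a • F^[k] z := by
      intro k
      induction k with
      | zero => intro a z; rfl
      | succ k ih => intro a z; simp only [Function.iterate_succ_apply, map_smulₛₗ, ih]
    rw [h, he, smul_zero]

/-- The standard Frobenius action on `H^j_I(R)`, induced by the Frobenius endomorphism of `R`. -/
noncomputable def stdFrobenius {n : ℕ} (f : Fin n → R) (j : ℕ) :
    LocCoh f R j →ₛₗ[frobenius R p] LocCoh f R j :=
  locCohMap f (isPowerLike_frobenius p) (frobenius R p).toSemilinearMap j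

/-- The bracket power `J^[p^e]`, generated by the `p^e`-th powers of the elements of `J`. -/
def bracketPow (J : Ideal R) (e : ℕ) : Ideal R := J.map (iterateFrobenius R p e)

theorem bracketPow_bracketPow (J : Ideal R) (e k : ℕ) :
    bracketPow p (bracketPow p J e) k = bracketPow p J (e + k) := by
  rw [bracketPow, bracketPow, bracketPow, Ideal.map_map]
  congr 1
  ext x
  simp [iterateFrobenius_def, pow_add, pow_mul]

/-- The map `R/J → R/K`, `x + J ↦ x^(p^e) + K`, for an ideal `K` containing `J^[p^e]`. -/
def frobQuot {J K : Ideal R} (e : ℕ) (h : bracketPow p J e ≤ K) :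
    (R ⧸ J) →ₛₗ[iterateFrobenius R p e] (R ⧸ K) :=
  Submodule.mapQ J K (iterateFrobenius R p e).toSemilinearMap
    fun _ hx => h (Ideal.mem_map_of_mem _ hx)

/-- The relative Frobenius action `F_R^e : H^j_I(R/J) → H^j_I(R/J^[p^e])`. -/
noncomputable def relFrobenius {n : ℕ} (f : Fin n → R) (J : Ideal R) (j e : ℕ) :
    LocCoh f (R ⧸ J) j →ₛₗ[iterateFrobenius R p e] LocCoh f (R ⧸ bracketPow p J e) j :=
  locCohMap f (isPowerLike_iterateFrobenius p e) (frobQuot p e le_rfl) j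

theorem relFrobenius_add_eq_zero {n : ℕ} (f : Fin n → R) (J : Ideal R) (j e k : ℕ)
    {ξ : LocCoh f (R ⧸ J) j} (h : relFrobenius p f J j e ξ = 0) :
    relFrobenius p f J j (e + k) ξ = 0 := by
  rw [relFrobenius, locCohMap_comp f (isPowerLike_iterateFrobenius p e)
    (isPowerLike_iterateFrobenius p k) (isPowerLike_iterateFrobenius p (e + k))
    (fun r => by simp [iterateFrobenius_def, pow_add, pow_mul]) (frobQuot p e le_rfl)
    (frobQuot p k (bracketPow_bracketPow p J e k).le)]
  · rw [relFrobenius] at h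
    rw [h, map_zero]
  · intro m
    obtain ⟨x, rfl⟩ := Submodule.Quotient.mk_surjective _ m
    change Submodule.Quotient.mk (iterateFrobenius R p (e + k) x) =
      Submodule.Quotient.mk (iterateFrobenius R p k (iterateFrobenius R p e x))
    simp [iterateFrobenius_def, pow_add, pow_mul]

/-- The relative Frobenius closure of zero `0^{F_R}` in `H^j_I(R/J)`. -/
noncomputable def relZeroFrobClosure {n : ℕ} (f : Fin n → R) (J : Ideal R) (j : ℕ) :
    Submodule R (LocCoh f (R ⧸ J) j) where
  carrier := {ξ | ∃ e : ℕ, relFrobenius p f J j e ξ = 0}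
  zero_mem' := ⟨0, map_zero _⟩
  add_mem' := by
    rintro x y ⟨e, he⟩ ⟨e', he'⟩
    refine ⟨e + e', ?_⟩
    rw [map_add, relFrobenius_add_eq_zero p f J j e e' he, add_comm e e',
      relFrobenius_add_eq_zero p f J j e' e he', add_zero]
  smul_mem' := by
    rintro r x ⟨e, he⟩
    exact ⟨e, by rw [map_smulₛₗ, he, smul_zero]⟩

end Frobenius

/-! ### Parameters -/

section Parameters

variable {R : Type*} [CommRing R]

/-- The ideal `(x₁, …, x_i)` generated by the first `i` terms of a sequence. -/
def initialIdeal {t : ℕ} (x : Fin t → R) (i : ℕ) : Ideal R :=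
  Ideal.span (x '' {k | (k : ℕ) < i})

variable [IsLocalRing R]

/-- `x` is a full system of parameters: it has `dim R` terms and generates an ideal primary to the
maximal ideal. -/
def IsSystemOfParameters {d : ℕ} (x : Fin d → R) : Prop :=
  ringKrullDim R = d ∧ (Ideal.span (Set.range x)).radical = IsLocalRing.maximalIdeal R

/-- `x` is a filter regular sequence: each `x_i` lies in the maximal ideal and in no associated
prime of `R/(x₁, …, x_{i-1})` other than the maximal ideal. -/
def IsFilterRegular {t : ℕ} (x : Fin t → R) : Prop :=
  ∀ i : Fin t, x i ∈ IsLocalRing.maximalIdeal R ∧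
    ∀ P ∈ associatedPrimes R (R ⧸ initialIdeal x i), P ≠ IsLocalRing.maximalIdeal R → x i ∉ P

/-- `R` is generalized weakly F-nilpotent: `H^j_𝔪(R) / 0^F` has finite length for all `j < dim R`.
Here `f` is a sequence of generators of the maximal ideal `𝔪`, used to compute `H^j_𝔪`. -/
def IsGenWeaklyFNilpotent (p : ℕ) [ExpChar R p] {n : ℕ} (f : Fin n → R) : Prop :=
  ∀ j : ℕ, (j : WithBot ℕ∞) < ringKrullDim R →
    IsFiniteLength R (LocCoh f R j ⧸ zeroFrobClosure p (stdFrobenius p f j))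

end Parameters

end FNilp

/-! Finite length gives one `N` with `𝔪 ^ N` multiplying `H^j_𝔪(R)` into `0^F` for all `j < d`.
Induction on `i` shows that `𝔪 ^ (2 ^ i * N)` multiplies `H^j_𝔪(R/𝔮_i^[p^e])` into its relative
Frobenius closure of zero whenever `i + j < d`, for every `e` at once and with an exponent
independent of the sequence. Since `𝔮^[p^e] ⊆ 𝔪 ^ (p ^ e)`, any `e ≥ 2 ^ d * N` suffices.

The inductive step, `AnnihilatesUpToFrob.sup_span_singleton`, is a connecting-homomorphism argument
on Čech cochains. With `J` the earlier ideal and `x` the new element, lift a cocycle over `(J +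
(x))^[p^e]` to a cochain over `J^[p^e]`; its coboundary is `x ^ p ^ e` times a cocycle of degree `j
+ 1`. One factor from the ideal makes that cocycle Frobenius nilpotent, which corrects a Frobenius
image of the lift to a cocycle over a bracket power of `J`; a second factor makes this one nilpotent
too. The correction is a multiple of a power of `x` and dies in the quotient. Two factors are spent
per step, hence the doubling.

Dividing by `x ^ p ^ e` needs the powers `x_k ^ p ^ e` to be filter regular again. This is checked
in the localizations `R_u`, `u ∈ 𝔪`, where filter regular becomes weakly regular and powers of
weakly regular sequences are weakly regular. -/

namespace FNilp

/-! ### Powers of weakly regular and of filter regular sequences -/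

section RegularSequences

open RingTheory.Sequence Function
open scoped Pointwise

variable {R : Type*} [CommRing R]

/-- A sequence that is weakly regular on both ends of a short exact sequence is weakly regular on
the middle term. -/
theorem isWeaklyRegular_of_exact {M' M M'' : Type*} [AddCommGroup M'] [Module R M']
    [AddCommGroup M] [Module R M] [AddCommGroup M''] [Module R M''] (rs : List R)
    (f : M' →ₗ[R] M) (g : M →ₗ[R] M'') (hf : Injective f) (hfg : Exact f g) (hg : Surjective g)
    (h' : IsWeaklyRegular M' rs) (h'' : IsWeaklyRegular M'' rs) : IsWeaklyRegular M rs := by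
  induction rs generalizing M' M M'' with
  | nil => exact .nil R M
  | cons r rs ih =>
    rw [isWeaklyRegular_cons_iff] at h' h'' ⊢
    refine ⟨isSMulRegular_of_range_eq_ker hf hfg.linearMap_ker_eq.symm h'.1 h''.1, ?_⟩
    refine ih (QuotSMulTop.map r f) (QuotSMulTop.map r g) ?_ (QuotSMulTop.map_exact r hfg hg)
      (QuotSMulTop.map_surjective r hg) h'.2 h''.2
    have h0 : Exact (0 : M' →ₗ[R] M') f := by
      rw [LinearMap.exact_iff, LinearMap.ker_eq_bot.2 hf, LinearMap.range_zero]
    -- Regularity of `r` on `M''` keeps the sequence left exact modulo `r`.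
    have h1 := QuotSMulTop.map_first_exact_on_four_term_exact_of_isSMulRegular_last h0 hfg h''.1
    rw [LinearMap.exact_iff, map_zero, LinearMap.range_zero] at h1
    exact LinearMap.ker_eq_bot.1 h1

theorem isWeaklyRegular_of_subsingleton (M : Type*) [AddCommGroup M] [Module R M]
    [Subsingleton M] (rs : List R) : IsWeaklyRegular M rs := by
  refine ⟨fun i hi a b _ => ?_⟩
  exact (Submodule.mkQ_surjective _).subsingleton.elim a b

/-- Induction along `0 → M/r^a M → M/r^(a+1) M → M/rM → 0`, whose first map is multiplication by
`r`, injective because `r` is regular on `M`. -/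
theorem isWeaklyRegular_quotSMulTop_pow {M : Type*} [AddCommGroup M] [Module R M] {r : R}
    (hr : IsSMulRegular M r) {rs : List R} (h : IsWeaklyRegular (QuotSMulTop r M) rs) (a : ℕ) :
    IsWeaklyRegular (QuotSMulTop (r ^ a) M) rs := by
  induction a with
  | zero =>
    have : Subsingleton (QuotSMulTop (r ^ 0) M) := by
      rw [Submodule.Quotient.subsingleton_iff, pow_zero, eq_top_iff]
      exact fun x _ => ⟨x, trivial, one_smul _ _⟩
    exact isWeaklyRegular_of_subsingleton _ _
  | succ a ih =>
    have hle : r ^ a • (⊤ : Submodule R M) ≤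
        (r ^ (a + 1) • (⊤ : Submodule R M)).comap (LinearMap.lsmul R M r) := by
      rintro _ ⟨x, -, rfl⟩
      exact ⟨x, trivial, by simp [pow_succ, smul_smul, mul_comm]⟩
    have hle' : r ^ (a + 1) • (⊤ : Submodule R M) ≤ r • (⊤ : Submodule R M) := by
      rintro _ ⟨x, -, rfl⟩
      exact ⟨r ^ a • x, trivial, by simp [pow_succ, smul_smul, mul_comm]⟩
    refine isWeaklyRegular_of_exact rs
      (Submodule.mapQ (r ^ a • (⊤ : Submodule R M)) (r ^ (a + 1) • (⊤ : Submodule R M)) _ hle)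
      (Submodule.factor hle') ?_ ?_ (Submodule.factor_surjective hle') ih h
    · rw [← LinearMap.ker_eq_bot, LinearMap.ker_eq_bot']
      intro m hm
      obtain ⟨m, rfl⟩ := Submodule.Quotient.mk_surjective _ m
      rw [Submodule.mapQ_apply, Submodule.Quotient.mk_eq_zero] at hm
      obtain ⟨x, -, hx⟩ := hm
      rw [Submodule.Quotient.mk_eq_zero]
      refine ⟨x, trivial, hr ?_⟩
      simpa [pow_succ', smul_smul] using hx
    · intro m
      obtain ⟨m, rfl⟩ := Submodule.Quotient.mk_surjective _ m
      rw [← Submodule.mkQ_apply, Submodule.factor_mk, Submodule.mkQ_apply,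
        Submodule.Quotient.mk_eq_zero]
      constructor
      · rintro ⟨x, -, hx⟩
        refine ⟨Submodule.Quotient.mk x, ?_⟩
        rw [Submodule.mapQ_apply]
        exact congrArg _ hx
      · rintro ⟨y, hy⟩
        obtain ⟨y, rfl⟩ := Submodule.Quotient.mk_surjective _ y
        rw [Submodule.mapQ_apply, Submodule.mkQ_apply, Submodule.Quotient.eq] at hy
        have h1 := Submodule.sub_mem _ (⟨y, trivial, rfl⟩ : r • y ∈ r • (⊤ : Submodule R M))
          (hle' hy)
        simpa using h1

theorem isWeaklyRegular_map_pow {M : Type*} [AddCommGroup M] [Module R M] {rs : List R}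
    (h : IsWeaklyRegular M rs) (a : ℕ) : IsWeaklyRegular M (rs.map (· ^ a)) := by
  induction rs generalizing M with
  | nil => exact .nil R M
  | cons r rs ih =>
    rw [isWeaklyRegular_cons_iff] at h
    rw [List.map_cons, isWeaklyRegular_cons_iff]
    exact ⟨h.1.pow a, ih (isWeaklyRegular_quotSMulTop_pow h.1 h.2 a)⟩

theorem ofList_take_ofFn {t : ℕ} (x : Fin t → R) (i : ℕ) :
    Ideal.ofList ((List.ofFn x).take i) = initialIdeal x i := by
  rw [Ideal.ofList, initialIdeal]
  congr 1
  ext r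
  simp only [Set.mem_ofPred_eq, List.mem_take_iff_getElem, List.getElem_ofFn, Set.mem_image,
    List.length_ofFn]
  constructor
  · rintro ⟨k, hk, rfl⟩
    exact ⟨⟨k, by omega⟩, by simp only; omega, rfl⟩
  · rintro ⟨k, hk, rfl⟩
    exact ⟨k, by omega, rfl⟩

theorem initialIdeal_map {S : Type*} [CommRing S] (φ : R →+* S) {t : ℕ} (x : Fin t → R) (i : ℕ) :
    (initialIdeal x i).map φ = initialIdeal (fun k => φ (x k)) i := by
  rw [initialIdeal, initialIdeal, Ideal.map_span, Set.image_image]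

/-- Weak regularity of a finite sequence in a localization `R_u`, in terms of `R`. -/
theorem isWeaklyRegular_away_iff (u : R) {t : ℕ} (x : Fin t → R) :
    IsWeaklyRegular (Localization.Away u)
        (List.ofFn fun k => algebraMap R (Localization.Away u) (x k)) ↔
      ∀ k : Fin t, ∀ b, x k * b ∈ initialIdeal x k → ∃ n, u ^ n * b ∈ initialIdeal x k := by
  have key : ∀ (k : ℕ) (b : R), algebraMap R (Localization.Away u) b ∈
      initialIdeal (fun k => algebraMap R (Localization.Away u) (x k)) k ↔
        ∃ n, u ^ n * b ∈ initialIdeal x k := by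
    intro k b
    rw [← initialIdeal_map, IsLocalization.algebraMap_mem_map_algebraMap_iff (Submonoid.powers u)]
    simp [Submonoid.mem_powers_iff]
  have hreg : ∀ k : Fin t, IsSMulRegular (Localization.Away u ⧸
      initialIdeal (fun k => algebraMap R (Localization.Away u) (x k)) k)
        (algebraMap R (Localization.Away u) (x k)) ↔
      ∀ b, x k * b ∈ initialIdeal x k → ∃ n, u ^ n * b ∈ initialIdeal x k := by
    intro k
    rw [isSMulRegular_quotient_iff_mem_of_smul_mem]
    constructor
    · intro h b hb
      refine (key k b).1 (h _ ?_)
      rw [smul_eq_mul, ← map_mul]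
      exact (key k _).2 ⟨0, by simpa using hb⟩
    · intro h z hz
      obtain ⟨n, b, hb⟩ := IsLocalization.Away.surj u z
      have hu : IsUnit (algebraMap R (Localization.Away u) u ^ n) :=
        (IsLocalization.Away.algebraMap_isUnit u).pow n
      rw [← Ideal.mul_unit_mem_iff_mem _ hu, hb]
      have h1 := Ideal.mul_mem_right (algebraMap R (Localization.Away u) u ^ n) _ hz
      rw [smul_eq_mul, mul_assoc, hb, ← map_mul, key] at h1
      obtain ⟨m, hm⟩ := h1
      obtain ⟨l, hl⟩ := h (u ^ m * b) (by convert hm using 1; ring)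
      exact (key k b).2 ⟨l + m, by rw [pow_add, mul_assoc]; exact hl⟩
  simp only [isSMulRegular_quotient_iff_mem_of_smul_mem] at hreg
  rw [isWeaklyRegular_iff]
  simp only [isSMulRegular_quotient_iff_mem_of_smul_mem, smul_eq_mul, Ideal.mul_top,
    ofList_take_ofFn, List.getElem_ofFn, List.length_ofFn] at hreg ⊢
  constructor
  · intro h k
    exact (hreg k).1 (h k k.2)
  · intro h k hk
    exact (hreg ⟨k, hk⟩).2 (h ⟨k, hk⟩)

/-- The hypothesis says that `x` is weakly regular in `R_u`, a property that passes to powers there;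
the conclusion translates this back to `R`. -/
theorem exists_pow_mul_mem_initialIdeal_pow {u : R} {t : ℕ} {x : Fin t → R}
    (h : ∀ k : Fin t, ∀ b, x k * b ∈ initialIdeal x k → ∃ n, u ^ n * b ∈ initialIdeal x k)
    (a : ℕ) (k : Fin t) (b : R) (hb : x k ^ a * b ∈ initialIdeal (fun l => x l ^ a) k) :
    ∃ n, u ^ n * b ∈ initialIdeal (fun l => x l ^ a) k := by
  have h1 := isWeaklyRegular_map_pow ((isWeaklyRegular_away_iff u x).2 h) a
  rw [List.map_ofFn] at h1
  have h2 : (fun l => algebraMap R (Localization.Away u) (x l ^ a)) =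
      (fun y => y ^ a) ∘ fun l => algebraMap R (Localization.Away u) (x l) := by
    funext l
    simp
  rw [← h2] at h1
  exact (isWeaklyRegular_away_iff u fun l => x l ^ a).1 h1 k b hb

/-- If every associated prime of `R/I` that contains `y` is maximal, then the elements of `R/I`
killed by `y` are killed by powers of the elements of `𝔪`. -/
theorem exists_pow_mul_mem_of_associatedPrimes [IsLocalRing R] [IsNoetherianRing R] {I : Ideal R}
    {y : R} (h : ∀ P ∈ associatedPrimes R (R ⧸ I), P ≠ IsLocalRing.maximalIdeal R → y ∉ P)
    {u : R} (hu : u ∈ IsLocalRing.maximalIdeal R) {b : R} (hb : y * b ∈ I) :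
    ∃ n, u ^ n * b ∈ I := by
  have hann : ∀ r : R, r ∈ Module.annihilator R (Submodule.span R {Ideal.Quotient.mk I b}) ↔
      r * b ∈ I := by
    intro r
    rw [← Submodule.annihilator, Submodule.mem_annihilator_span_singleton,
      ← Ideal.Quotient.eq_zero_iff_mem, map_mul]
    rfl
  suffices hrad : u ∈ (Module.annihilator R
      (Submodule.span R {Ideal.Quotient.mk I b})).radical by
    obtain ⟨n, hn⟩ := hrad
    exact ⟨n, (hann _).1 hn⟩
  -- Minimal primes over the annihilator of the class of `b` are associated primes of `R/I`, and
  -- they contain `y`. So only `𝔪` can occur, and it contains `u`.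
  rw [← Ideal.sInf_minimalPrimes, Submodule.mem_sInf]
  intro P hP
  have hass := Module.associatedPrimes.minimalPrimes_annihilator_subset_associatedPrimes R _ hP
  have hass' := associatedPrimes.subset_of_injective
    (Submodule.injective_subtype (Submodule.span R {Ideal.Quotient.mk I b})) hass
  have hyP : y ∈ P := hP.1.2 ((hann y).2 hb)
  by_contra huP
  exact h P hass' (fun hPm => huP (hPm ▸ hu)) hyP

end RegularSequences

/-! ### Bracket powers of ideals -/

section Bracket

variable {R : Type*} [CommRing R] (p : ℕ) [ExpChar R p]

theorem bracketPow_sup (I J : Ideal R) (e : ℕ) :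
    bracketPow p (I ⊔ J) e = bracketPow p I e ⊔ bracketPow p J e :=
  Ideal.map_sup _ _ _

theorem bracketPow_span_singleton (x : R) (e : ℕ) :
    bracketPow p (Ideal.span {x}) e = Ideal.span {x ^ p ^ e} := by
  rw [bracketPow, Ideal.map_span, Set.image_singleton, iterateFrobenius_def]

theorem bracketPow_bot (e : ℕ) : bracketPow p (⊥ : Ideal R) e = ⊥ := Ideal.map_bot

theorem bracketPow_mono {I J : Ideal R} (h : I ≤ J) (e : ℕ) :
    bracketPow p I e ≤ bracketPow p J e := Ideal.map_mono h

theorem bracketPow_zero (I : Ideal R) : bracketPow p I 0 = I := by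
  rw [bracketPow, iterateFrobenius_zero, Ideal.map_id]

theorem bracketPow_le_pow {I J : Ideal R} (h : I ≤ J) (e : ℕ) :
    bracketPow p I e ≤ J ^ p ^ e := by
  rw [bracketPow, Ideal.map_le_iff_le_comap]
  intro y hy
  rw [Ideal.mem_comap, iterateFrobenius_def]
  exact Ideal.pow_mem_pow (h hy) _

theorem bracketPow_initialIdeal {t : ℕ} (x : Fin t → R) (i e : ℕ) :
    bracketPow p (initialIdeal x i) e = initialIdeal (fun k => x k ^ p ^ e) i := by
  rw [bracketPow, initialIdeal_map]
  simp only [iterateFrobenius_def]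

end Bracket

theorem initialIdeal_zero {R : Type*} [CommRing R] {t : ℕ} (x : Fin t → R) :
    initialIdeal x 0 = ⊥ := by
  simp [initialIdeal]

theorem initialIdeal_succ {R : Type*} [CommRing R] {t : ℕ} (x : Fin t → R) (i : Fin t) :
    initialIdeal x (i + 1) = initialIdeal x i ⊔ Ideal.span {x i} := by
  rw [initialIdeal, initialIdeal, ← Ideal.span_union, ← Set.image_singleton, ← Set.image_union]
  congr 2
  ext k
  simp only [Set.mem_ofPred_eq, Set.mem_union, Set.mem_singleton_iff, Fin.ext_iff]
  omega

/-! ### Lifting and cancelling in localized modules -/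

section AwayModule

variable {R : Type*} [CommRing R] {M N : Type*} [AddCommGroup M] [Module R M]
  [AddCommGroup N] [Module R N] {σ : R →+* R} (hσ : IsPowerLike σ) {g : M →ₛₗ[σ] N}

theorem awayFunctor_surjective (hid : ∀ r, σ r = r) (hg : Function.Surjective g) (a : R) :
    Function.Surjective (awayFunctor hσ g a) := by
  intro z
  induction z using LocalizedModule.induction_on with
  | _ m u =>
    obtain ⟨x, rfl⟩ := hg m
    refine ⟨LocalizedModule.mk x u, ?_⟩
    rw [awayFunctor_mk]
    congr 1
    ext
    exact hid _

theorem exists_eq_smul_of_awayFunctor_eq_zero (hid : ∀ r, σ r = r) {y : R}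
    (hg : ∀ m, g m = 0 → ∃ m', m = y • m') {a : R} {z : Away a M}
    (hz : awayFunctor hσ g a z = 0) : ∃ w : Away a M, z = y • w := by
  induction z using LocalizedModule.induction_on with
  | _ m u =>
    rw [awayFunctor_mk, ← LocalizedModule.zero_mk 1, LocalizedModule.mk_eq] at hz
    obtain ⟨w, hw⟩ := hz
    obtain ⟨m', hm'⟩ := hg ((w : R) • m) (by
      rw [map_smulₛₗ, hid]
      simpa [Submonoid.smul_def] using hw)
    refine ⟨LocalizedModule.mk m' (w * u), ?_⟩
    rw [LocalizedModule.smul'_mk, ← LocalizedModule.mk_cancel_common_left w u,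
      Submonoid.smul_def, hm']

theorem away_eq_zero_of_smul_eq_zero {y a : R}
    (hy : ∀ m : M, y • m = 0 → ∃ n : ℕ, a ^ n • m = 0) {z : Away a M} (hz : y • z = 0) :
    z = 0 := by
  induction z using LocalizedModule.induction_on with
  | _ m u =>
    rw [LocalizedModule.smul'_mk, ← LocalizedModule.zero_mk 1, LocalizedModule.mk_eq] at hz
    obtain ⟨w, hw⟩ := hz
    obtain ⟨n, hn⟩ := hy ((w : R) • m) (by
      rw [smul_comm]
      simpa [Submonoid.smul_def] using hw)
    rw [← LocalizedModule.zero_mk 1, LocalizedModule.mk_eq]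
    refine ⟨⟨_, n, rfl⟩ * w, ?_⟩
    rw [one_smul, smul_zero, smul_zero, mul_smul, Submonoid.smul_def, Submonoid.smul_def]
    exact hn

end AwayModule

/-! ### Relative Frobenius on Čech cochains and the inductive step -/

section Cochains

variable {R : Type*} [CommRing R] (p : ℕ) [ExpChar R p] {n : ℕ} (f : Fin n → R)

theorem cochainMap_mem_coboundaries {M N : Type*} [AddCommGroup M] [Module R M] [AddCommGroup N]
    [Module R N] {σ : R →+* R} (hσ : IsPowerLike σ) (g : M →ₛₗ[σ] N) {j : ℕ}
    {c : Cochain f M j} (hc : c ∈ coboundaries f M j) :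
    cochainMap f hσ g j c ∈ coboundaries f N j := by
  cases j with
  | zero =>
    have h0 : c = 0 := hc
    rw [h0, map_zero]
    exact zero_mem _
  | succ j =>
    obtain ⟨b, rfl⟩ := hc
    exact ⟨cochainMap f hσ g j b, cochainMap_cechD f hσ g b⟩

/-- The map of Čech cochains induced by `R/J → R/K`, `x + J ↦ x^(p^e) + K`. For `e = 0` it is the
map induced by the projection. -/
noncomputable def frobCochain {J K : Ideal R} (e : ℕ) (h : bracketPow p J e ≤ K) (j : ℕ) :
    Cochain f (R ⧸ J) j →ₛₗ[iterateFrobenius R p e] Cochain f (R ⧸ K) j :=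
  cochainMap f (isPowerLike_iterateFrobenius p e) (frobQuot p e h) j

/-- Arbitrary target ideals and a free exponent `m` avoid transport between `(J^[p^e])^[p^k]` and
`J^[p^(e+k)]`. Exponent `0` covers compatibility with projections. -/
theorem frobCochain_frobCochain {J K L : Ideal R} {e k m : ℕ} (hm : e + k = m)
    (h : bracketPow p J e ≤ K)
    (h' : bracketPow p K k ≤ L) (h'' : bracketPow p J m ≤ L) (j : ℕ)
    (c : Cochain f (R ⧸ J) j) :
    frobCochain p f k h' j (frobCochain p f e h j c) = frobCochain p f m h'' j c := by
  subst hm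
  ext s
  change awayFunctor (isPowerLike_iterateFrobenius p k) (frobQuot p k h') _
      (awayFunctor (isPowerLike_iterateFrobenius p e) (frobQuot p e h) _ (c s)) =
    awayFunctor (isPowerLike_iterateFrobenius p (e + k)) (frobQuot p (e + k) h'') _ (c s)
  induction c s using LocalizedModule.induction_on with
  | _ m u =>
    obtain ⟨x, rfl⟩ := Submodule.Quotient.mk_surjective _ m
    simp only [awayFunctor_mk]
    have hpow : ∀ y : R, iterateFrobenius R p k (iterateFrobenius R p e y) =
        iterateFrobenius R p (e + k) y := fun y => by
      simp [iterateFrobenius_def, pow_add, pow_mul]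
    congr 1
    · change Submodule.Quotient.mk (iterateFrobenius R p k (iterateFrobenius R p e x)) =
        Submodule.Quotient.mk (iterateFrobenius R p (e + k) x)
      rw [hpow]
    · ext
      exact hpow _

theorem cechD_frobCochain {J K : Ideal R} (e : ℕ) (h : bracketPow p J e ≤ K) {j : ℕ}
    (c : Cochain f (R ⧸ J) j) :
    cechD f (R ⧸ K) j (frobCochain p f e h j c) =
      frobCochain p f e h (j + 1) (cechD f (R ⧸ J) j c) :=
  cochainMap_cechD f _ _ c

theorem frobCochain_mem_coboundaries {J K : Ideal R} (e : ℕ) (h : bracketPow p J e ≤ K) {j : ℕ}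
    {c : Cochain f (R ⧸ J) j} (hc : c ∈ coboundaries f (R ⧸ J) j) :
    frobCochain p f e h j c ∈ coboundaries f (R ⧸ K) j :=
  cochainMap_mem_coboundaries f _ _ hc

theorem frobCochain_smul {J K : Ideal R} (e : ℕ) (h : bracketPow p J e ≤ K) {j : ℕ} (a : R)
    (c : Cochain f (R ⧸ J) j) :
    frobCochain p f e h j (a • c) = a ^ p ^ e • frobCochain p f e h j c := by
  rw [map_smulₛₗ, iterateFrobenius_def]

theorem frobQuot_zero_mk {J K : Ideal R} (h : bracketPow p J 0 ≤ K) (x : R) :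
    frobQuot p 0 h (Submodule.Quotient.mk x) = Submodule.Quotient.mk x := by
  change Submodule.Quotient.mk (iterateFrobenius R p 0 x) = _
  simp

theorem iterateFrobenius_zero_eq_self (r : R) : iterateFrobenius R p 0 r = r := by
  simp

theorem frobCochain_zero_surjective {J K : Ideal R} (h : bracketPow p J 0 ≤ K) (j : ℕ) :
    Function.Surjective (frobCochain p f 0 h j) := by
  intro c
  choose b hb using fun s => awayFunctor_surjective (isPowerLike_iterateFrobenius p 0)
    (g := frobQuot p 0 h) (iterateFrobenius_zero_eq_self p) (fun m => by
      obtain ⟨x, rfl⟩ := Submodule.Quotient.mk_surjective _ m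
      exact ⟨_, frobQuot_zero_mk p h x⟩) _ (c s)
  exact ⟨b, funext hb⟩

theorem exists_eq_smul_of_frobCochain_zero_eq_zero {J K : Ideal R} {y : R}
    (hK : K = J ⊔ Ideal.span {y}) (h : bracketPow p J 0 ≤ K) {j : ℕ} {c : Cochain f (R ⧸ J) j}
    (hc : frobCochain p f 0 h j c = 0) : ∃ b : Cochain f (R ⧸ J) j, c = y • b := by
  have hg : ∀ m, frobQuot p 0 h m = 0 → ∃ m', m = y • m' := by
    intro m hm
    obtain ⟨x, rfl⟩ := Submodule.Quotient.mk_surjective _ m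
    rw [frobQuot_zero_mk, Submodule.Quotient.mk_eq_zero, hK] at hm
    obtain ⟨a, ha, b, hb, hab⟩ := Submodule.mem_sup.1 hm
    obtain ⟨t, rfl⟩ := Ideal.mem_span_singleton'.1 hb
    refine ⟨Submodule.Quotient.mk t, ?_⟩
    rw [← Submodule.Quotient.mk_smul, Submodule.Quotient.eq, smul_eq_mul, ← hab]
    convert ha using 1
    ring
  choose b hb using fun s => exists_eq_smul_of_awayFunctor_eq_zero
    (isPowerLike_iterateFrobenius p 0) (iterateFrobenius_zero_eq_self p) hg
    (show awayFunctor _ _ _ (c s) = 0 from congrFun hc s)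
  exact ⟨b, funext hb⟩

/-- An element `y` that is a nonzerodivisor on `R/J` up to `𝔪`-torsion is a nonzerodivisor on the
Čech cochains of positive degree. -/
theorem eq_zero_of_smul_cochain_eq_zero {J 𝔪 : Ideal R} (hf : ∀ i, f i ∈ 𝔪) {y : R}
    (hy : ∀ u ∈ 𝔪, ∀ b, y * b ∈ J → ∃ n, u ^ n * b ∈ J) {j : ℕ}
    {c : Cochain f (R ⧸ J) (j + 1)} (hc : y • c = 0) : c = 0 := by
  ext s
  have hu : ∏ k ∈ s.1, f k ∈ 𝔪 := by
    -- Positive degree matters here: in degree `0` the product is `1`, and torsion killed by powers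
    -- of `𝔪` survives.
    obtain ⟨i, hi⟩ : s.1.Nonempty := Finset.card_pos.1 (by rw [s.2]; omega)
    exact Ideal.mem_of_dvd _ (Finset.dvd_prod_of_mem f hi) (hf i)
  refine away_eq_zero_of_smul_eq_zero (y := y) (fun m hm => ?_) (congrFun hc s)
  obtain ⟨x, rfl⟩ := Submodule.Quotient.mk_surjective _ m
  rw [← Submodule.Quotient.mk_smul, Submodule.Quotient.mk_eq_zero] at hm
  obtain ⟨n, hn⟩ := hy _ hu x hm
  refine ⟨n, ?_⟩
  rw [← Submodule.Quotient.mk_smul, Submodule.Quotient.mk_eq_zero]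
  exact hn

theorem smul_cochain_eq_zero {K : Ideal R} {y : R} (hy : y ∈ K) {j : ℕ}
    (c : Cochain f (R ⧸ K) j) : y • c = 0 := by
  ext s
  change y • c s = 0
  induction c s using LocalizedModule.induction_on with
  | _ m u =>
    obtain ⟨x, rfl⟩ := Submodule.Quotient.mk_surjective _ m
    rw [LocalizedModule.smul'_mk, ← Submodule.Quotient.mk_smul,
      (Submodule.Quotient.mk_eq_zero K).2 (show y • x ∈ K from K.mul_mem_right x hy),
      LocalizedModule.zero_mk]

/-- The cochain `c` becomes a coboundary under some relative Frobenius action. -/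
def IsFrobNilpotent {J : Ideal R} {j : ℕ} (c : Cochain f (R ⧸ J) j) : Prop :=
  ∃ k, frobCochain p f k (le_refl (bracketPow p J k)) j c ∈
    coboundaries f (R ⧸ bracketPow p J k) j

variable {p f}

variable (p f) in
/-- The ideal `𝔞` multiplies all Čech cocycles of degree `j` of all `R/J^[p^e]` into the relative
Frobenius closure of the coboundaries. -/
def AnnihilatesUpToFrob (𝔞 J : Ideal R) (j : ℕ) : Prop :=
  ∀ (e : ℕ) (I : Ideal R), bracketPow p J e = I → ∀ a ∈ 𝔞,
    ∀ c ∈ cocycles f (R ⧸ I) j, IsFrobNilpotent p f (a • c)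

theorem mk_mem_relZeroFrobClosure_iff {I : Ideal R} {j : ℕ} (c : cocycles f (R ⧸ I) j) :
    (Submodule.Quotient.mk c : LocCoh f (R ⧸ I) j) ∈ relZeroFrobClosure p f I j ↔
      IsFrobNilpotent p f (c : Cochain f (R ⧸ I) j) := by
  refine exists_congr fun k => ?_
  rw [relFrobenius, locCohMap, Submodule.mapQ_apply, Submodule.Quotient.mk_eq_zero]
  rfl

theorem smul_top_le_relZeroFrobClosure_iff {𝔞 I : Ideal R} {j : ℕ} :
    𝔞 • (⊤ : Submodule R (LocCoh f (R ⧸ I) j)) ≤ relZeroFrobClosure p f I j ↔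
      ∀ a ∈ 𝔞, ∀ c ∈ cocycles f (R ⧸ I) j, IsFrobNilpotent p f (a • c) := by
  rw [Submodule.smul_le]
  constructor
  · intro h a ha c hc
    have h1 := h a ha (Submodule.Quotient.mk ⟨c, hc⟩) trivial
    rw [← Submodule.Quotient.mk_smul, mk_mem_relZeroFrobClosure_iff] at h1
    exact h1
  · intro h a ha ξ _
    obtain ⟨c, rfl⟩ := Submodule.Quotient.mk_surjective _ ξ
    rw [← Submodule.Quotient.mk_smul, mk_mem_relZeroFrobClosure_iff]
    exact h a ha c c.2

theorem IsFrobNilpotent.add {I : Ideal R} {j : ℕ} {c c' : Cochain f (R ⧸ I) j}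
    (hc : c ∈ cocycles f (R ⧸ I) j) (hc' : c' ∈ cocycles f (R ⧸ I) j)
    (h : IsFrobNilpotent p f c) (h' : IsFrobNilpotent p f c') : IsFrobNilpotent p f (c + c') :=
  (mk_mem_relZeroFrobClosure_iff (⟨c, hc⟩ + ⟨c', hc'⟩)).1
    (add_mem ((mk_mem_relZeroFrobClosure_iff ⟨c, hc⟩).2 h)
      ((mk_mem_relZeroFrobClosure_iff ⟨c', hc'⟩).2 h'))

/-- In a product `r * s`, the factor `r` handles the obstruction in degree `j + 1` and `s` the
corrected lift in degree `j`. -/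
theorem AnnihilatesUpToFrob.sup_span_singleton {𝔞 J 𝔪 : Ideal R} (hf : ∀ i, f i ∈ 𝔪) {x : R}
    (hx : ∀ e, ∀ u ∈ 𝔪, ∀ b, x ^ p ^ e * b ∈ bracketPow p J e →
      ∃ n, u ^ n * b ∈ bracketPow p J e) {j : ℕ}
    (h : AnnihilatesUpToFrob p f 𝔞 J j) (h' : AnnihilatesUpToFrob p f 𝔞 J (j + 1)) :
    AnnihilatesUpToFrob p f (𝔞 * 𝔞) (J ⊔ Ideal.span {x}) j := by
  intro e K hK r hr c hc
  induction hr using Submodule.mul_induction_on' with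
  | add r _ s _ hr hs =>
    rw [add_smul]
    exact hr.add (Submodule.smul_mem _ _ hc) (Submodule.smul_mem _ _ hc) hs
  | mem_mul_mem r hr s hs =>
    have hK' : K = bracketPow p J e ⊔ Ideal.span {x ^ p ^ e} := by
      rw [← hK, bracketPow_sup, bracketPow_span_singleton]
    have hJK : bracketPow p (bracketPow p J e) 0 ≤ K := by
      rw [bracketPow_zero, hK']
      exact le_sup_left
    have hc0 : cechD f (R ⧸ K) j c = 0 := hc
    -- a lift of `c` whose coboundary is divisible by `x ^ p ^ e`
    obtain ⟨b, hb⟩ := frobCochain_zero_surjective p f hJK j c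
    obtain ⟨w, hw⟩ := exists_eq_smul_of_frobCochain_zero_eq_zero p f hK' hJK
      (c := cechD f (R ⧸ bracketPow p J e) j b) (by rw [← cechD_frobCochain, hb, hc0])
    -- `x ^ p ^ e` times the coboundary of `w` is `d (d b) = 0`, and `x ^ p ^ e` cancels in degree
    -- `j + 2`.
    have hwc : w ∈ cocycles f (R ⧸ bracketPow p J e) (j + 1) := by
      refine eq_zero_of_smul_cochain_eq_zero f hf (hx e) ?_
      rw [← map_smul, ← hw, cechD_cechD]
    obtain ⟨k, g, hg⟩ := h' e _ rfl r hr w hwc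
    -- a cocycle comparing the two primitives
    have hz : frobCochain p f k (le_refl _) j (r • b) - x ^ p ^ (e + k) • g ∈
        cocycles f (R ⧸ bracketPow p (bracketPow p J e) k) j := by
      change cechD f _ j _ = 0
      rw [map_sub, map_smul _ (x ^ p ^ (e + k)), hg, cechD_frobCochain, map_smul _ r, hw,
        smul_comm r, frobCochain_smul p f k _ (x ^ p ^ e), ← pow_mul, ← pow_add, sub_self]
    -- The multiplier is `s ^ p ^ k`, not `s`, so that it can be absorbed into the `k`-th Frobenius
    -- as the image of `s`; it lies in `𝔞` because `p ^ k > 0`.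
    obtain ⟨l, hl⟩ := h (e + k) _ (bracketPow_bracketPow p J e k).symm _
      (Ideal.pow_mem_of_mem 𝔞 hs _ (pow_pos (expChar_pos R p) k)) _ hz
    have hIK : bracketPow p (bracketPow p J e) (k + l) ≤ bracketPow p K (k + l) := by
      refine bracketPow_mono p ?_ _
      rw [hK']
      exact le_sup_left
    have hIKl : bracketPow p (bracketPow p (bracketPow p J e) k) l ≤ bracketPow p K (k + l) := by
      rwa [bracketPow_bracketPow p (bracketPow p J e)]
    have hxK : (x ^ p ^ (e + k)) ^ p ^ l ∈ bracketPow p K (k + l) := by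
      rw [← hK, bracketPow_bracketPow, bracketPow_sup, bracketPow_span_singleton, ← pow_mul,
        ← pow_add, ← add_assoc]
      exact Ideal.mem_sup_right (Ideal.mem_span_singleton_self _)
    -- Project to `R/K^[p^(k+l)]`. There the term in `g` vanishes, its coefficient being divisible
    -- by `x ^ p ^ (e + k + l)`, and what remains is the Frobenius image of `(s * r) • c`.
    have h1 := frobCochain_mem_coboundaries p f 0 ((bracketPow_zero p _).trans_le hIKl) hl
    rw [frobCochain_frobCochain p f (add_zero l) _ _ hIKl, smul_sub, ← frobCochain_smul, map_sub,
      frobCochain_frobCochain p f rfl _ _ hIK, smul_comm (s ^ p ^ k),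
      frobCochain_smul p f l _ (x ^ p ^ (e + k)), smul_cochain_eq_zero f hxK, sub_zero] at h1
    refine ⟨k + l, ?_⟩
    rw [← hb, frobCochain_smul, frobCochain_frobCochain p f (zero_add (k + l)) _ _ hIK,
      ← frobCochain_smul, mul_comm r s, mul_smul]
    exact h1

end Cochains

/-- A module of finite length over a local ring is killed by a power of the maximal ideal. -/
theorem exists_pow_maximalIdeal_smul_top_eq_bot {R : Type*} [CommRing R] [IsLocalRing R]
    {M : Type*} [AddCommGroup M] [Module R M] (h : IsFiniteLength R M) :
    ∃ N : ℕ, IsLocalRing.maximalIdeal R ^ N • (⊤ : Submodule R M) = ⊥ := by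
  obtain ⟨_, _⟩ := isFiniteLength_iff_isNoetherian_isArtinian.1 h
  obtain ⟨N, hN⟩ := IsArtinian.monotone_stabilizes
    ⟨fun k => OrderDual.toDual (IsLocalRing.maximalIdeal R ^ k • (⊤ : Submodule R M)),
      fun a b hab => Submodule.smul_mono_left (Ideal.pow_le_pow_right hab)⟩
  -- Nakayama, applied where the descending chain `𝔪 ^ k M` becomes stationary.
  refine ⟨N, Submodule.eq_bot_of_le_smul_of_le_jacobson_bot (IsLocalRing.maximalIdeal R) _
    (IsNoetherian.noetherian _) ?_ (IsLocalRing.maximalIdeal_le_jacobson _)⟩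
  rw [← Submodule.mul_smul, ← pow_succ']
  exact (congrArg OrderDual.ofDual (hN (N + 1) N.le_succ)).le

/-! ### Base case: the Frobenius action on `H^j(R)` against the relative one on `H^j(R/0)` -/

section Frobenius

variable {R : Type*} [CommRing R] {p : ℕ} [ExpChar R p] {n : ℕ} {f : Fin n → R}

theorem stdFrobenius_iterate (j e : ℕ) (ξ : LocCoh f R j) :
    (stdFrobenius p f j)^[e] ξ = locCohMap f (isPowerLike_iterateFrobenius p e)
      (iterateFrobenius R p e).toSemilinearMap j ξ := by
  induction e with
  | zero =>
    obtain ⟨⟨c, hc⟩, rfl⟩ := Submodule.Quotient.mk_surjective _ ξ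
    rw [Function.iterate_zero, id, locCohMap, Submodule.mapQ_apply]
    congr 1
    ext s
    change c s = awayFunctor (isPowerLike_iterateFrobenius p 0)
      (iterateFrobenius R p 0).toSemilinearMap _ (c s)
    induction c s using LocalizedModule.induction_on with
    | _ m u =>
      rw [awayFunctor_mk]
      congr 1
      · exact (iterateFrobenius_zero_eq_self p m).symm
      · ext
        exact (iterateFrobenius_zero_eq_self p _).symm
  | succ e ih =>
    rw [Function.iterate_succ_apply', ih, stdFrobenius]
    have hc : ∀ r : R, iterateFrobenius R p (e + 1) r = frobenius R p (iterateFrobenius R p e r) :=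
      fun r => by rw [iterateFrobenius_def, iterateFrobenius_def, frobenius_def, pow_succ, pow_mul]
    exact (locCohMap_comp f _ _ _ hc _ _ _ hc j ξ).symm

theorem isPowerLike_id : IsPowerLike (RingHom.id R) := fun a => ⟨1, (pow_one a).symm⟩

/-- Here `g` inverts the projection `R → R/0`, so the relative action factors through the absolute
Frobenius of `R`. -/
theorem relFrobenius_bot (j e : ℕ) {ξ : LocCoh f (R ⧸ (⊥ : Ideal R)) j}
    {g : (R ⧸ (⊥ : Ideal R)) →ₗ[R] R} (hg : ∀ x, g (Submodule.Quotient.mk x) = x) :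
    relFrobenius p f ⊥ j e ξ = locCohMap f isPowerLike_id (Submodule.mkQ (bracketPow p ⊥ e)) j
      (locCohMap f (isPowerLike_iterateFrobenius p e) (iterateFrobenius R p e).toSemilinearMap j
        (locCohMap f isPowerLike_id g j ξ)) := by
  let φ : (R ⧸ (⊥ : Ideal R)) →ₛₗ[iterateFrobenius R p e] R :=
    (iterateFrobenius R p e).toSemilinearMap.comp g
  rw [← locCohMap_comp f isPowerLike_id (isPowerLike_iterateFrobenius p e)
    (isPowerLike_iterateFrobenius p e) (fun _ => rfl) g _ φ (fun _ => rfl), relFrobenius]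
  refine locCohMap_comp f _ _ _ (fun _ => rfl) φ _ _ (fun m => ?_) j ξ
  obtain ⟨x, rfl⟩ := Submodule.Quotient.mk_surjective _ m
  change Submodule.Quotient.mk (iterateFrobenius R p e x) =
    Submodule.Quotient.mk (iterateFrobenius R p e (g (Submodule.Quotient.mk x)))
  rw [hg]

theorem annihilatesUpToFrob_bot {𝔞 : Ideal R} {j : ℕ}
    (h : 𝔞 • (⊤ : Submodule R (LocCoh f R j)) ≤ zeroFrobClosure p (stdFrobenius p f j)) :
    AnnihilatesUpToFrob p f 𝔞 ⊥ j := by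
  rintro e I hI
  rw [bracketPow_bot] at hI
  subst hI
  rw [← smul_top_le_relZeroFrobClosure_iff, Submodule.smul_le]
  intro a ha ξ _
  let g : (R ⧸ (⊥ : Ideal R)) →ₗ[R] R := Submodule.liftQ ⊥ LinearMap.id bot_le
  have hg : ∀ x, g (Submodule.Quotient.mk x) = x := fun _ => rfl
  obtain ⟨k, hk⟩ := Submodule.smul_le.1 h a ha (locCohMap f isPowerLike_id g j ξ) trivial
  refine ⟨k, ?_⟩
  rw [relFrobenius_bot j k hg, map_smul (locCohMap f isPowerLike_id g j),
    ← stdFrobenius_iterate, hk, map_zero]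

end Frobenius

theorem AnnihilatesUpToFrob.mono {R : Type*} [CommRing R] {p : ℕ} [ExpChar R p] {n : ℕ}
    {f : Fin n → R} {𝔞 𝔟 J : Ideal R} {j : ℕ} (h : AnnihilatesUpToFrob p f 𝔞 J j) (hle : 𝔟 ≤ 𝔞) :
    AnnihilatesUpToFrob p f 𝔟 J j :=
  fun e I hI a ha => h e I hI a (hle ha)

/-! ### Uniform annihilation for filter regular sequences -/

section LocalRing

variable {R : Type*} [CommRing R] [IsLocalRing R] {p : ℕ} [ExpChar R p] {n : ℕ} {f : Fin n → R}

theorem IsGenWeaklyFNilpotent.exists_pow_smul_top_le {d : ℕ} (hd : ringKrullDim R = d)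
    (hR : IsGenWeaklyFNilpotent p f) : ∃ N : ℕ, ∀ j < d,
      IsLocalRing.maximalIdeal R ^ N • (⊤ : Submodule R (LocCoh f R j)) ≤
        zeroFrobClosure p (stdFrobenius p f j) := by
  have : ∀ j, ∃ N : ℕ, j < d →
      IsLocalRing.maximalIdeal R ^ N • (⊤ : Submodule R (LocCoh f R j)) ≤
        zeroFrobClosure p (stdFrobenius p f j) := by
    intro j
    by_cases hj : j < d
    · obtain ⟨N, hN⟩ := exists_pow_maximalIdeal_smul_top_eq_bot
        (hR j (by rw [hd]; exact_mod_cast hj))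
      refine ⟨N, fun _ => ?_⟩
      have h1 := congrArg (Submodule.comap
        (zeroFrobClosure p (stdFrobenius p f j)).mkQ) hN
      rw [Submodule.comap_bot, Submodule.ker_mkQ] at h1
      rw [← h1, ← Submodule.map_le_iff_le_comap, Submodule.map_smul'']
      exact Submodule.smul_mono le_rfl le_top
    · exact ⟨0, fun h => absurd h hj⟩
  choose N hN using this
  -- Only finitely many degrees occur, so the largest exponent serves them all.
  refine ⟨(Finset.range d).sup N, fun j hj => le_trans ?_ (hN j hj)⟩
  exact Submodule.smul_mono_left
    (Ideal.pow_le_pow_right (Finset.le_sup (f := N) (Finset.mem_range.2 hj)))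

theorem IsFilterRegular.exists_pow_mul_mem [IsNoetherianRing R] {t : ℕ} {x : Fin t → R}
    (hx : IsFilterRegular x) (e : ℕ) (k : Fin t) {u : R} (hu : u ∈ IsLocalRing.maximalIdeal R) {b : R}
    (hb : x k ^ p ^ e * b ∈ bracketPow p (initialIdeal x k) e) :
    ∃ m, u ^ m * b ∈ bracketPow p (initialIdeal x k) e := by
  rw [bracketPow_initialIdeal] at hb ⊢
  exact exists_pow_mul_mem_initialIdeal_pow
    (fun l _ h => exists_pow_mul_mem_of_associatedPrimes (hx l).2 hu h) _ k b hb

/-- Step `i + 1` in degree `j` uses step `i` in degrees `j` and `j + 1`, which is why the range is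
`i + j < d`. `N` is fixed by `R` alone, so the exponent does not depend on `x`. -/
theorem IsFilterRegular.annihilatesUpToFrob [IsNoetherianRing R] {d N : ℕ} {x : Fin d → R}
    (hx : IsFilterRegular x)
    (hf : ∀ i, f i ∈ IsLocalRing.maximalIdeal R)
    (hN : ∀ j < d, IsLocalRing.maximalIdeal R ^ N • (⊤ : Submodule R (LocCoh f R j)) ≤
      zeroFrobClosure p (stdFrobenius p f j)) (i j : ℕ) (hij : i + j < d) :
    AnnihilatesUpToFrob p f (IsLocalRing.maximalIdeal R ^ (2 ^ i * N)) (initialIdeal x i) j := by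
  induction i generalizing j with
  | zero =>
    rw [initialIdeal_zero, pow_zero, one_mul]
    exact annihilatesUpToFrob_bot (hN j (by omega))
  | succ i ih =>
    obtain ⟨k, rfl⟩ : ∃ k : Fin d, (k : ℕ) = i := ⟨⟨i, by omega⟩, rfl⟩
    have hreg : ∀ e, ∀ u ∈ IsLocalRing.maximalIdeal R, ∀ b,
        x k ^ p ^ e * b ∈ bracketPow p (initialIdeal x k) e →
          ∃ m, u ^ m * b ∈ bracketPow p (initialIdeal x k) e :=
      fun e u hu b hb => hx.exists_pow_mul_mem e k hu hb
    have h := AnnihilatesUpToFrob.sup_span_singleton hf hreg (ih j (by omega))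
      (ih (j + 1) (by omega))
    rwa [← initialIdeal_succ x k, ← pow_add, ← two_mul, ← mul_assoc, ← pow_succ'] at h

end LocalRing

end FNilp

theorem mainTheorem3 {R : Type*} [CommRing R] [IsLocalRing R] [IsNoetherianRing R]
    (p : ℕ) [Fact p.Prime] [CharP R p]
    (d : ℕ) (hd : ringKrullDim R = d)
    {n : ℕ} (f : Fin n → R) (hf : Ideal.span (Set.range f) = IsLocalRing.maximalIdeal R)
    (hR : FNilp.IsGenWeaklyFNilpotent p f) :
    ∃ e₀ : ℕ, ∀ e : ℕ, e₀ ≤ e → ∀ x : Fin d → R,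
      FNilp.IsSystemOfParameters x → FNilp.IsFilterRegular x →
      ∀ i j : ℕ, i + j < d →
        FNilp.bracketPow p (Ideal.span (Set.range x)) e •
            (⊤ : Submodule R
              (FNilp.LocCoh f (R ⧸ FNilp.bracketPow p (FNilp.initialIdeal x i) e) j)) ≤
          FNilp.relZeroFrobClosure p f (FNilp.bracketPow p (FNilp.initialIdeal x i) e) j := by
  have hfm : ∀ i, f i ∈ IsLocalRing.maximalIdeal R :=
    fun i => hf ▸ Ideal.subset_span (Set.mem_range_self i)
  obtain ⟨N, hN⟩ := hR.exists_pow_smul_top_le hd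
  -- This bounds every exponent `2 ^ i * N` that occurs, and `e < p ^ e` turns `e ≥ 2 ^ d * N` into
  -- `𝔪 ^ (p ^ e) ⊆ 𝔪 ^ (2 ^ i * N)`.
  refine ⟨2 ^ d * N, fun e he x _ hx i j hij => ?_⟩
  have hp : 1 < p := (Fact.out : p.Prime).one_lt
  have hle : 2 ^ i * N ≤ p ^ e := calc
    2 ^ i * N ≤ 2 ^ d * N := Nat.mul_le_mul_right N (Nat.pow_le_pow_right two_pos (by omega))
    _ ≤ e := he
    _ ≤ p ^ e := (Nat.lt_pow_self hp).le
  have hxm : Ideal.span (Set.range x) ≤ IsLocalRing.maximalIdeal R := by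
    rw [Ideal.span_le]
    rintro _ ⟨k, rfl⟩
    exact (hx k).1
  exact FNilp.smul_top_le_relZeroFrobClosure_iff.2 <|
    ((hx.annihilatesUpToFrob hfm hN i j hij).mono
      ((FNilp.bracketPow_le_pow p hxm e).trans (Ideal.pow_le_pow_right hle))) e _ rfl
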